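/- Let $G$ be a connected reductive algebraic group over an algebraically closed field $\mathbb{K}$ of characteristic $p>0$, realised as a Zariski closed subgroup of some $GL_n(\mathbb{K})$. Let $T$ be a maximal torus of $G$ and $B\supseteq T$ a Borel subgroup of $G$. Write $\mathfrak h=\mathrm{Lie}(T)\subseteq\mathfrak b=\mathrm{Lie}(B)\subseteq\mathfrak g=\mathrm{Lie}(G)$, with $p$-th power map $x\mapsto x^{[p]}$; let $\Phi^+$ be the set of roots of $G$ with respect to $T$ whose root spaces lie in $\mathfrak b$, let $N=|\Phi^+|$, and let $\mathfrak n^+=\bigoplus_{\alpha\in\Phi^+}\mathfrak g_\alpha$, so that $\mathfrak b=\mathfrak h\oplus\mathfrak n^+$. Put $\mathfrak b^\perp=\{\chi\in\mathfrak g^*\mid\chi(\mathfrak b)=0\}$, with its Zariski topology as a finite-dimensional vector space, and $\Lambda_0=\{\lambda\in\mathfrak h^*\mid \lambda(h)^p-\lambda(h^{[p]})=0\text{ for all }h\in\mathfrak h\}$. For $\chi\in\mathfrak g^*$ let $U_\chi(\mathfrak g)=U(\mathfrak g)/\langle x^p-x^{[p]}-\chi(x)^p\mid x\in\mathfrak g\rangle$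 be the reduced enveloping algebra. For $\chi\in\mathfrak b^\perp$ and $\lambda\in\Lambda_0$ let $Z_\chi(\lambda)=U_\chi(\mathfrak g)\otimes_{U_\chi(\mathfrak b)}\mathbb{K}_\lambda$ be the baby Verma module, where $\mathbb{K}_\lambda$ is the one-dimensional $\mathfrak b$-module on which $\mathfrak n^+$ acts as zero and $\mathfrak h$ acts via $\lambda$. Equivalently, $Z_\chi(\lambda)$ is the quotient of $U_\chi(\mathfrak g)$ by the left ideal generated by $\mathfrak n^+$ and all $h-\lambda(h)$, $h\in\mathfrak h$. Let $\lambda\in\Lambda_0$ and $0\le k\le N$. Suppose that there exists $\chi_\lambda\in\mathfrak b^\perp$ such that every $U_{\chi_\lambda}(\mathfrak g)$-submodule of $Z_{\chi_\lambda}(\lambda)$ has dimension over $\mathbb{K}$ divisible by $p^k$. Then $$V_\lambda=\{\mu\in\mathfrak b^\perp\mid\text{every }U_\mu(\mathfrak g)\text{-submodule of }Z_\mu(\lambda)\text{ has dimension divisible by }p^k\}$$ is a dense open subset of $\mathfrak b^\perp$. -/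

import Mathlib

open Module
open scoped Topology

-- The commutator bracket on associative algebras (here: square matrices).
attribute [local instance 100] LieRing.ofAssociativeRing

/-! ### Zariski topologies -/

/-- Given a family of coordinate functions `c` on `X` with values in a field `K`, the topology on
`X` whose basic open sets are the non-vanishing loci of polynomials in the coordinates. -/
@[reducible] def zariskiOf {K X σ : Type*} [Field K] (c : X → σ → K) : TopologicalSpace X :=
  TopologicalSpace.generateFrom
    {U | ∃ f : MvPolynomial σ K, U = {x | MvPolynomial.eval (c x) f ≠ 0}}

/-- The Zariski topology on a (finite-dimensional) vector space: polynomial functions are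
polynomials in linear forms. -/
@[reducible] def zariskiVec (K V : Type*) [Field K] [AddCommGroup V] [Module K V] : TopologicalSpace V :=
  zariskiOf (fun (v : V) (l : Dual K V) => l v)

/-! ### Linear algebraic groups -/

section LinearAlgebraicGroups

variable {K : Type*} [Field K] {n : ℕ}


/-- The `n²` matrix entries of a matrix. -/
def entries (A : Matrix (Fin n) (Fin n) K) : Fin n × Fin n → K := fun ij => A ij.1 ij.2

/-- The Zariski topology on `GL_n(K)`. (As the determinant is invertible on `GL_n(K)`, inverting it
does not produce further open sets.) -/
@[reducible] def zariskiGL (K : Type*) [Field K] (n : ℕ) : TopologicalSpace (GL (Fin n) K) :=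
  zariskiOf fun g => entries (g : Matrix (Fin n) (Fin n) K)

/-- `G` is a Zariski closed subgroup of `GL_n(K)`, i.e. a linear algebraic group. -/
def IsClosedSubgroup (G : Subgroup (GL (Fin n) K)) : Prop :=
  IsClosed[zariskiGL K n] (G : Set (GL (Fin n) K))

/-- `G` is a Zariski closed subgroup of `GL_n(K)` that is connected in the Zariski topology. -/
def IsConnectedClosedSubgroup (G : Subgroup (GL (Fin n) K)) : Prop :=
  IsClosedSubgroup G ∧ @IsConnected _ (zariskiGL K n) (G : Set (GL (Fin n) K))

/-- All elements of `U` are unipotent matrices. -/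
def IsUnipotentSubgroup (U : Subgroup (GL (Fin n) K)) : Prop :=
  ∀ u ∈ U, IsNilpotent ((u : Matrix (Fin n) (Fin n) K) - 1)

/-- Connected reductive group: the unipotent radical (the largest closed connected normal
unipotent subgroup) is trivial. -/
def IsConnectedReductive (G : Subgroup (GL (Fin n) K)) : Prop :=
  IsConnectedClosedSubgroup G ∧
    ∀ U : Subgroup (GL (Fin n) K), U ≤ G → (U.subgroupOf G).Normal →
      IsConnectedClosedSubgroup U → IsUnipotentSubgroup U → U = ⊥

/-- Torus: a closed connected diagonalizable subgroup. -/
def IsTorus (T : Subgroup (GL (Fin n) K)) : Prop :=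
  IsConnectedClosedSubgroup T ∧
    ∃ P : GL (Fin n) K, ∀ t ∈ T, ((P * t * P⁻¹ : GL (Fin n) K) : Matrix (Fin n) (Fin n) K).IsDiag

/-- `T` is a maximal torus of `G`. -/
def IsMaximalTorus (G T : Subgroup (GL (Fin n) K)) : Prop :=
  Maximal (fun S => IsTorus S ∧ S ≤ G) T

/-- `B` is a Borel subgroup of `G`: a maximal closed connected solvable subgroup. -/
def IsBorelSubgroup (G B : Subgroup (GL (Fin n) K)) : Prop :=
  Maximal (fun S => IsConnectedClosedSubgroup S ∧ Group.IsSolvable S ∧ S ≤ G) B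

/-! ### The Lie algebra of a linear algebraic group -/

/-- `f` vanishes on `G`. -/
def VanishesOn (G : Subgroup (GL (Fin n) K)) (f : MvPolynomial (Fin n × Fin n) K) : Prop :=
  ∀ g ∈ G, MvPolynomial.eval (entries (g : Matrix (Fin n) (Fin n) K)) f = 0

/-- `X` is a tangent vector to `G` at the identity: the differential at `1` of each polynomial
vanishing on `G` kills `X`. -/
def IsTangent (G : Subgroup (GL (Fin n) K)) (X : Matrix (Fin n) (Fin n) K) : Prop :=
  ∀ f : MvPolynomial (Fin n × Fin n) K, VanishesOn G f →
    ∑ ij, MvPolynomial.eval (entries (1 : Matrix (Fin n) (Fin n) K)) (MvPolynomial.pderiv ij f) *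
      X ij.1 ij.2 = 0

/-- The left invariant derivation of the polynomial ring in the matrix entries attached to a
matrix. (Only used to prove that the tangent space at `1` is closed under commutators and `p`-th
powers.) -/
noncomputable def invDer (X : Matrix (Fin n) (Fin n) K) :
    Derivation K (MvPolynomial (Fin n × Fin n) K) (MvPolynomial (Fin n × Fin n) K) :=
  MvPolynomial.mkDerivation K fun ij =>
    ∑ k, MvPolynomial.X (ij.1, k) * MvPolynomial.C (X k ij.2)

theorem invDer_X (X : Matrix (Fin n) (Fin n) K) (ij : Fin n × Fin n) :
    invDer X (MvPolynomial.X ij) =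
      ∑ k, MvPolynomial.X (ij.1, k) * MvPolynomial.C (X k ij.2) :=
  MvPolynomial.mkDerivation_X ..

theorem derivation_mul_C {σ : Type*}
    (D : Derivation K (MvPolynomial σ K) (MvPolynomial σ K)) (f : MvPolynomial σ K) (a : K) :
    D (f * MvPolynomial.C a) = D f * MvPolynomial.C a := by
  have h : D (MvPolynomial.C a) = 0 := D.map_algebraMap a
  rw [D.leibniz, h, smul_zero, zero_add, smul_eq_mul, mul_comm]

theorem invDer_invDer_X (X Y : Matrix (Fin n) (Fin n) K) (ij : Fin n × Fin n) :
    invDer X (invDer Y (MvPolynomial.X ij)) = invDer (X * Y) (MvPolynomial.X ij) := by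
  simp only [invDer_X, map_sum, derivation_mul_C, Matrix.mul_apply, Finset.sum_mul,
    Finset.mul_sum, map_mul]
  rw [Finset.sum_comm]
  simp only [mul_assoc]

theorem invDer_lie (X Y : Matrix (Fin n) (Fin n) K) : invDer ⁅X, Y⁆ = ⁅invDer X, invDer Y⁆ := by
  refine MvPolynomial.derivation_ext fun ij => ?_
  rw [Derivation.commutator_apply, invDer_invDer_X, invDer_invDer_X, Ring.lie_def]
  simp only [invDer_X, Matrix.sub_apply, map_sub, mul_sub, Finset.sum_sub_distrib]

theorem eval_one_invDer (X : Matrix (Fin n) (Fin n) K) (f : MvPolynomial (Fin n × Fin n) K) :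
    MvPolynomial.eval (entries (1 : Matrix (Fin n) (Fin n) K)) (invDer X f) =
      ∑ ij, MvPolynomial.eval (entries (1 : Matrix (Fin n) (Fin n) K))
        (MvPolynomial.pderiv ij f) * X ij.1 ij.2 := by
  classical
  induction f using MvPolynomial.induction_on with
  | C a =>
    have h : invDer X (MvPolynomial.C a) = 0 := (invDer X).map_algebraMap a
    simp [h]
  | add f g hf hg => simp only [map_add, hf, hg, add_mul, Finset.sum_add_distrib]
  | mul_X f i hf =>
    simp only [Derivation.leibniz, map_add, smul_eq_mul, map_mul, hf, add_mul,
      Finset.sum_add_distrib, invDer_X, MvPolynomial.pderiv_X, MvPolynomial.eval_X, map_sum,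
      MvPolynomial.eval_C]
    congr 1
    · simp only [mul_assoc, ← Finset.mul_sum]
      congr 1
      rw [Finset.sum_eq_single i, Finset.sum_eq_single i.1]
      · simp [entries]
      · intro b _ hb
        simp [entries, Matrix.one_apply_ne (Ne.symm hb)]
      · simp
      · intro b _ hb
        simp [Pi.single_eq_of_ne (Ne.symm hb)]
      · simp
    · simp only [mul_assoc, ← Finset.mul_sum]

/-- Left translation on polynomials in the matrix entries. -/
noncomputable def leftTrans (A : Matrix (Fin n) (Fin n) K) :
    MvPolynomial (Fin n × Fin n) K →ₐ[K] MvPolynomial (Fin n × Fin n) K :=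
  MvPolynomial.aeval fun ij => ∑ k, MvPolynomial.C (A ij.1 k) * MvPolynomial.X (k, ij.2)

theorem eval_leftTrans (A B : Matrix (Fin n) (Fin n) K) (f : MvPolynomial (Fin n × Fin n) K) :
    MvPolynomial.eval (entries B) (leftTrans A f) = MvPolynomial.eval (entries (A * B)) f := by
  induction f using MvPolynomial.induction_on with
  | C a => simp [leftTrans]
  | add f g hf hg => simp only [map_add, hf, hg]
  | mul_X f i hf =>
    simp only [map_mul, hf]
    congr 1
    simp [leftTrans, entries, Matrix.mul_apply]

theorem invDer_leftTrans (A X : Matrix (Fin n) (Fin n) K) (f : MvPolynomial (Fin n × Fin n) K) :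
    invDer X (leftTrans A f) = leftTrans A (invDer X f) := by
  induction f using MvPolynomial.induction_on with
  | C a =>
    have h : invDer X (MvPolynomial.C a) = 0 := (invDer X).map_algebraMap a
    simp [leftTrans, h]
  | add f g hf hg => simp only [map_add, hf, hg]
  | mul_X f i hf =>
    have key : invDer X (leftTrans A (MvPolynomial.X i)) =
        leftTrans A (invDer X (MvPolynomial.X i)) := by
      have h (a : K) (j : Fin n × Fin n) :
          invDer X (MvPolynomial.C a * MvPolynomial.X j) =
            MvPolynomial.C a * invDer X (MvPolynomial.X j) := by
        rw [mul_comm, derivation_mul_C, mul_comm]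
      simp only [invDer_X, leftTrans, MvPolynomial.aeval_X, map_sum, h, map_mul,
        MvPolynomial.algHom_C, MvPolynomial.algebraMap_eq, Finset.mul_sum, Finset.sum_mul]
      rw [Finset.sum_comm]
      simp only [mul_assoc]
    simp only [map_mul, Derivation.leibniz, map_add, smul_eq_mul, hf, key]

theorem isTangent_iff (G : Subgroup (GL (Fin n) K)) (X : Matrix (Fin n) (Fin n) K) :
    IsTangent G X ↔ ∀ f, VanishesOn G f → VanishesOn G (invDer X f) := by
  constructor
  · intro hX f hf g hg
    have h1 : VanishesOn G (leftTrans (g : Matrix (Fin n) (Fin n) K) f) := fun x hx => by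
      rw [eval_leftTrans]
      exact hf (g * x) (G.mul_mem hg hx)
    have h2 := hX _ h1
    rwa [← eval_one_invDer, invDer_leftTrans, eval_leftTrans, mul_one] at h2
  · intro h f hf
    have := h f hf 1 G.one_mem
    rw [← eval_one_invDer]
    exact this

/-- The Lie algebra of a closed subgroup `G` of `GL_n(K)`: the tangent space at `1`, with the
commutator bracket of matrices. -/
def lieAlg (G : Subgroup (GL (Fin n) K)) : LieSubalgebra K (Matrix (Fin n) (Fin n) K) where
  carrier := {X | IsTangent G X}
  add_mem' {X Y} hX hY f hf := by
    simp only [Matrix.add_apply, mul_add, Finset.sum_add_distrib]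
    rw [hX f hf, hY f hf, add_zero]
  zero_mem' f _ := by simp
  smul_mem' c X hX f hf := by
    have h := hX f hf
    simp only [Matrix.smul_apply, smul_eq_mul, mul_left_comm _ c]
    rw [← Finset.mul_sum, h, mul_zero]
  lie_mem' {X Y} hX hY := by
    have hX' : IsTangent G X := hX
    have hY' : IsTangent G Y := hY
    change IsTangent G ⁅X, Y⁆
    rw [isTangent_iff] at hX' hY' ⊢
    intro f hf g hg
    rw [invDer_lie, Derivation.commutator_apply, map_sub, hX' _ (hY' _ hf) g hg,
      hY' _ (hX' _ hf) g hg, sub_zero]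

theorem derivation_iterate_mul {A : Type*} [CommRing A] [Algebra K A] (p : ℕ) [Fact p.Prime]
    [CharP K p] (D : Derivation K A A) (a b : A) :
    D^[p] (a * b) = D^[p] a * b + a * D^[p] b := by
  have key (m : ℕ) : D^[m] (a * b) =
      ∑ ij ∈ Finset.HasAntidiagonal.antidiagonal m, m.choose ij.1 • (D^[ij.1] a * D^[ij.2] b) := by
    induction m with
    | zero => simp
    | succ m ih =>
      rw [Finset.sum_antidiagonal_choose_succ_nsmul (M := A) (fun i j => D^[i] a * D^[j] b) m,
        Function.iterate_succ_apply', ih, map_sum, ← Finset.sum_add_distrib]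
      refine Finset.sum_congr rfl fun ij hij => ?_
      have hc : m.choose ij.2 = m.choose ij.1 :=
        (Nat.choose_symm_of_eq_add (Finset.HasAntidiagonal.mem_antidiagonal.mp hij).symm).symm
      simp only [map_nsmul, Derivation.leibniz, smul_eq_mul, Function.iterate_succ_apply', hc,
        smul_add]
      congr 2
      ring
  have hp : p.Prime := Fact.out
  rw [key p, Finset.Nat.sum_antidiagonal_eq_sum_range_succ_mk, Finset.sum_range_succ,
    Finset.sum_eq_single 0]
  · simp [add_comm]
  · intro i hi hi0
    have hdvd : p ∣ p.choose i :=
      hp.dvd_choose_self hi0 (Finset.mem_range.mp hi)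
    have h0 : ((p.choose i : ℕ) : K) = 0 := (CharP.cast_eq_zero_iff K p _).mpr hdvd
    rw [← Nat.cast_smul_eq_nsmul K, h0, zero_smul]
  · intro h
    exact absurd (Finset.mem_range.mpr hp.pos) h

theorem invDer_iterate (p : ℕ) [Fact p.Prime] [CharP K p] (X : Matrix (Fin n) (Fin n) K)
    (f : MvPolynomial (Fin n × Fin n) K) : (invDer X)^[p] f = invDer (X ^ p) f := by
  have hX (m : ℕ) (i : Fin n × Fin n) :
      (invDer X)^[m + 1] (MvPolynomial.X i) = invDer (X ^ (m + 1)) (MvPolynomial.X i) := by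
    induction m with
    | zero => simp
    | succ m ih => rw [Function.iterate_succ_apply', ih, invDer_invDer_X, ← pow_succ']
  obtain ⟨m, hm⟩ := Nat.exists_eq_succ_of_ne_zero (Fact.out : p.Prime).ne_zero
  induction f using MvPolynomial.induction_on with
  | C a =>
    have h (Y : Matrix (Fin n) (Fin n) K) : invDer Y (MvPolynomial.C a) = 0 :=
      (invDer Y).map_algebraMap a
    rw [h, hm, Nat.succ_eq_add_one, Function.iterate_add_apply, Function.iterate_one, h]
    exact Function.iterate_fixed (map_zero _) m
  | add f g hf hg => rw [iterate_map_add, hf, hg, map_add]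
  | mul_X f i hf =>
    have hi : (invDer X)^[p] (MvPolynomial.X i) = invDer (X ^ p) (MvPolynomial.X i) := by
      rw [hm]; exact hX m i
    rw [derivation_iterate_mul, hf, hi, Derivation.leibniz, smul_eq_mul, smul_eq_mul]
    ring

theorem pow_mem_lieAlg (p : ℕ) [Fact p.Prime] [CharP K p] (G : Subgroup (GL (Fin n) K))
    (x : lieAlg G) : (x : Matrix (Fin n) (Fin n) K) ^ p ∈ lieAlg G := by
  have hx : IsTangent G (x : Matrix (Fin n) (Fin n) K) := x.2
  change IsTangent G _
  rw [isTangent_iff] at hx ⊢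
  intro f hf
  rw [← invDer_iterate]
  have h (m : ℕ) : VanishesOn G ((invDer (x : Matrix (Fin n) (Fin n) K))^[m] f) := by
    induction m with
    | zero => exact hf
    | succ m ih => rw [Function.iterate_succ_apply']; exact hx _ ih
  exact h p

/-- The restricted structure `x ↦ x^[p]` on the Lie algebra of a closed subgroup of `GL_n(K)`: the
`p`-th power of matrices. -/
def pMap (p : ℕ) [Fact p.Prime] [CharP K p] (G : Subgroup (GL (Fin n) K)) (x : lieAlg G) :
    lieAlg G :=
  ⟨(x : Matrix (Fin n) (Fin n) K) ^ p, pow_mem_lieAlg p G x⟩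

/-! ### Roots -/

/-- The weight space `𝔤_α = {X ∈ 𝔤 | t X t⁻¹ = α(t) X for all t ∈ T}`. -/
def weightSpace (G T : Subgroup (GL (Fin n) K)) (α : T →* Kˣ) :
    Submodule K (Matrix (Fin n) (Fin n) K) where
  carrier := {X | X ∈ lieAlg G ∧ ∀ t : T,
    ((t : GL (Fin n) K) : Matrix (Fin n) (Fin n) K) * X *
      (((t : GL (Fin n) K)⁻¹ : GL (Fin n) K) : Matrix (Fin n) (Fin n) K) = (α t : K) • X}
  add_mem' {X Y} hX hY :=
    ⟨add_mem hX.1 hY.1, fun t => by rw [mul_add, add_mul, hX.2 t, hY.2 t, smul_add]⟩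
  zero_mem' := ⟨zero_mem _, fun t => by simp⟩
  smul_mem' c X hX :=
    ⟨(lieAlg G).smul_mem c hX.1, fun t => by
      rw [Matrix.mul_smul, Matrix.smul_mul, hX.2 t, smul_comm]⟩

/-- The roots of `G` with respect to `T`: the non-trivial characters with a non-zero weight space
in the Lie algebra of `G`. (A homomorphism `T → Kˣ` with a non-zero weight space is automatically
a morphism of algebraic groups.) -/
def roots (G T : Subgroup (GL (Fin n) K)) : Set (T →* Kˣ) :=
  {α | α ≠ 1 ∧ weightSpace G T α ≠ ⊥}

/-- The positive roots: the roots of `G` whose root spaces lie in the Lie algebra of the Borel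
subgroup `B`. -/
def posRoots (G B T : Subgroup (GL (Fin n) K)) : Set (T →* Kˣ) :=
  {α ∈ roots G T | ∀ X ∈ weightSpace G T α, X ∈ lieAlg B}

/-- `𝔫⁺`, the sum of the root spaces of the positive roots. -/
def nPlus (G B T : Subgroup (GL (Fin n) K)) : Submodule K (Matrix (Fin n) (Fin n) K) :=
  ⨆ α ∈ posRoots G B T, weightSpace G T α

/-- `𝔟^⊥ = {χ ∈ 𝔤^* | χ(𝔟) = 0}`. -/
def bPerp (G B : Subgroup (GL (Fin n) K)) : Submodule K (Dual K (lieAlg G)) where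
  carrier := {χ | ∀ x : lieAlg G, (x : Matrix (Fin n) (Fin n) K) ∈ lieAlg B → χ x = 0}
  add_mem' {χ ψ} hχ hψ x hx := by rw [LinearMap.add_apply, hχ x hx, hψ x hx, add_zero]
  zero_mem' _ _ := rfl
  smul_mem' c χ hχ x hx := by rw [LinearMap.smul_apply, hχ x hx, smul_zero]

/-- `Λ₀ = {λ ∈ 𝔥^* | λ(h)^p - λ(h^[p]) = 0 for all h ∈ 𝔥}`, where `𝔥` is the Lie algebra of `T`. -/
def Lambda0 (p : ℕ) [Fact p.Prime] [CharP K p] (T : Subgroup (GL (Fin n) K)) :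
    Set (Dual K (lieAlg T)) :=
  {lam | ∀ h : lieAlg T, lam h ^ p - lam (pMap p T h) = 0}

end LinearAlgebraicGroups

/-! ### Reduced enveloping algebras and baby Verma modules -/

/-- The relations `x^p - x^[p] = χ(x)^p`, `x ∈ L`, in the universal enveloping algebra of `L`. -/
inductive ReducedRel {K L : Type*} [Field K] [LieRing L] [LieAlgebra K L] (p : ℕ) (pm : L → L)
    (χ : Dual K L) : UniversalEnvelopingAlgebra K L → UniversalEnvelopingAlgebra K L → Prop
  | rel (x : L) : ReducedRel p pm χ
      (UniversalEnvelopingAlgebra.ι K x ^ p - UniversalEnvelopingAlgebra.ι K (pm x))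
      (algebraMap K (UniversalEnvelopingAlgebra K L) (χ x ^ p))

/-- The reduced enveloping algebra `U(L) / ⟨x^p - x^[p] - χ(x)^p | x ∈ L⟩` of a Lie algebra `L` with
`p`-th power map `pm`. -/
abbrev ReducedEnvelopingAlgebra {K L : Type*} [Field K] [LieRing L] [LieAlgebra K L] (p : ℕ)
    (pm : L → L) (χ : Dual K L) : Type _ :=
  RingQuot (ReducedRel p pm χ)

section BabyVerma

variable {K : Type*} [Field K] {n : ℕ} (p : ℕ) [Fact p.Prime] [CharP K p]

/-- `U_χ(𝔤)` for `𝔤` the Lie algebra of `G`. -/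
abbrev UChi (G : Subgroup (GL (Fin n) K)) (χ : Dual K (lieAlg G)) : Type _ :=
  ReducedEnvelopingAlgebra p (pMap p G) χ

/-- The canonical map `𝔤 → U_χ(𝔤)`. -/
noncomputable def toUChi (G : Subgroup (GL (Fin n) K)) (χ : Dual K (lieAlg G)) (x : lieAlg G) :
    UChi p G χ :=
  RingQuot.mkAlgHom K (ReducedRel p (pMap p G) χ) (UniversalEnvelopingAlgebra.ι K x)

/-- The left ideal of `U_χ(𝔤)` generated by `𝔫⁺` and all `h - λ(h)` with `h ∈ 𝔥`. -/
def babyVermaIdeal (G B T : Subgroup (GL (Fin n) K)) (χ : Dual K (lieAlg G))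
    (lam : Dual K (lieAlg T)) : Submodule (UChi p G χ) (UChi p G χ) :=
  Submodule.span (UChi p G χ)
    ({u | ∃ x : lieAlg G, (x : Matrix (Fin n) (Fin n) K) ∈ nPlus G B T ∧ u = toUChi p G χ x} ∪
     {u | ∃ (x : lieAlg G) (hx : (x : Matrix (Fin n) (Fin n) K) ∈ lieAlg T),
        u = toUChi p G χ x - algebraMap K (UChi p G χ) (lam ⟨x, hx⟩)})

/-- The baby Verma module `Z_χ(λ) = U_χ(𝔤) ⊗_{U_χ(𝔟)} K_λ`. The one-dimensional `U_χ(𝔟)`-module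
`K_λ`, on which `𝔫⁺` acts as zero and `𝔥` acts via `λ`, is the quotient of `U_χ(𝔟)` by the left ideal
generated by `𝔫⁺` and all `h - λ(h)`, so the induced module is the quotient of `U_χ(𝔤)` by the left
ideal with the same generators. -/
abbrev BabyVerma (G B T : Subgroup (GL (Fin n) K)) (χ : Dual K (lieAlg G))
    (lam : Dual K (lieAlg T)) : Type _ :=
  UChi p G χ ⧸ babyVermaIdeal p G B T χ lam

/-- Every `U_χ(𝔤)`-submodule of `Z_χ(λ)` has `K`-dimension divisible by `p^k`. -/
def AllSubmodulesDivisible (G B T : Subgroup (GL (Fin n) K)) (χ : Dual K (lieAlg G))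
    (lam : Dual K (lieAlg T)) (k : ℕ) : Prop :=
  ∀ M : Submodule (UChi p G χ) (BabyVerma p G B T χ lam), p ^ k ∣ finrank K M

/-- `V_λ ⊆ 𝔟^⊥`: the `μ` such that all submodules of `Z_μ(λ)` have dimension divisible by `p^k`. -/
def divisibleLocus (G B T : Subgroup (GL (Fin n) K)) (lam : Dual K (lieAlg T)) (k : ℕ) :
    Set (bPerp G B) :=
  {μ | AllSubmodulesDivisible p G B T (μ : Dual K (lieAlg G)) lam k}

end BabyVerma

/-!
A submodule `M` of the baby Verma module `Z_μ(λ)` and the quotient `Z_μ(λ)/M` have complementary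
dimensions, so `V_λ` is the set of `μ` for which all *quotients* of `Z_μ(λ)` have dimension
divisible by `p^k`. A quotient of dimension `e` is an `e`-dimensional representation of `𝔤` with
`p`-character `μ` generated by a vector that is killed by `𝔫⁺` and on which `𝔥` acts via `λ`. In
this form no basis of `Z_μ(λ)`, hence no Poincaré–Birkhoff–Witt theorem, is needed. Straightening
products of basis elements of `𝔤` shows that products of at most `N = dim 𝔤 · (p - 1)` of them
span `U_μ(𝔤)` (`letterSpan_pow_succ_le`). Therefore `e` is bounded independently of `μ`, and that
the vector generates can be expressed by polynomial equations in finitely many auxiliary scalars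
(`IsCyclicDatum`), which makes sense over every commutative `K`-algebra.

For each `e` the set `E` of those `μ` that admit such a representation is closed, by a valuative
argument (`hasCyclicDatum_of_forall_eval_ne_zero`). Let `μ₀` be in the closure of `E`. The
representations over all points of `E` form one over the ring of functions on `E`, and by the
choice of `μ₀` some prime ideal of that ring contains no polynomial function that is non-zero at
`μ₀`. This gives a representation over a field `F` at a point of which `μ₀` is a specialisation,
and a valuation ring of `F` centred at `μ₀`. Again by straightening, the representation has a
lattice over the valuation ring (`exists_isCyclicDatum_of_valuationRing`), whose reduction is a
representation of dimension `e` at `μ₀` over an extension of `K`. Since `K` is algebraically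
closed, there is also one over `K` (`exists_isCyclicDatum_of_extension`).

So `V_λ` is a finite intersection of open sets. It is non-empty by assumption, and dense because a
vector space over an infinite field is irreducible (`dense_of_isOpen_zariskiVec`).
-/

/-! ### Straightening words -/

section Straightening

variable {R A ι : Type*} [CommRing R] [Ring A] [Algebra R A]

/-- The letters of the words used below: the `X i`, and `1` for the blank letter `none`. -/
def letter {A ι : Type*} [One A] (X : ι → A) (o : Option ι) : A := o.elim 1 X

/-- The product of a word of `N` letters. Blanks stand for `1`, so that words of `N` letters
account for all products of at most `N` of the `X i`. -/
def word {A ι : Type*} [Monoid A] (X : ι → A) {N : ℕ} (w : Fin N → Option ι) : A :=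
  (List.ofFn fun i => letter X (w i)).prod

theorem map_word {A A' ι : Type*} [Semiring A] [Semiring A'] (f : A →+* A') (X : ι → A) {N : ℕ}
    (w : Fin N → Option ι) : f (word X w) = word (fun i => f (X i)) w := by
  rw [word, word, map_list_prod, List.map_ofFn]
  congr 2
  funext i
  simp only [Function.comp_apply, letter]
  cases w i <;> simp

variable (R) in
/-- The span of `1` and the `X i`. Its powers filter the subalgebra generated by the `X i`. -/
def letterSpan (X : ι → A) : Submodule R A := Submodule.span R (Set.range (letter X))

theorem letter_mem_letterSpan (X : ι → A) (o : Option ι) : letter X o ∈ letterSpan R X :=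
  Submodule.subset_span ⟨o, rfl⟩

theorem mem_letterSpan (X : ι → A) (i : ι) : X i ∈ letterSpan R X :=
  letter_mem_letterSpan X (some i)

theorem one_le_letterSpan (X : ι → A) : 1 ≤ letterSpan R X :=
  Submodule.one_le.mpr (letter_mem_letterSpan X none)

theorem letterSpan_pow_mono (X : ι → A) {m m' : ℕ} (h : m ≤ m') :
    letterSpan R X ^ m ≤ letterSpan R X ^ m' :=
  pow_le_pow_right' (one_le_letterSpan X) h

theorem letterSpan_pow_eq_span_word (X : ι → A) (N : ℕ) :
    letterSpan R X ^ N = Submodule.span R (Set.range fun w : Fin N → Option ι => word X w) := by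
  rw [letterSpan, Submodule.span_pow]
  congr 1
  ext a
  rw [Set.mem_pow]
  constructor
  · rintro ⟨f, rfl⟩
    choose w hw using fun i => (f i).2
    exact ⟨w, by simp only [word, hw]⟩
  · rintro ⟨w, rfl⟩
    exact ⟨fun i => ⟨letter X (w i), w i, rfl⟩, rfl⟩

theorem prod_map_mem_letterSpan_pow (X : ι → A) (l : List ι) :
    (l.map X).prod ∈ letterSpan R X ^ l.length := by
  induction l with
  | nil => simpa using ⟨(1 : R), map_one _⟩
  | cons i l ih =>
    rw [List.map_cons, List.prod_cons, List.length_cons, pow_succ']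
    exact Submodule.mul_mem_mul (mem_letterSpan X i) ih

theorem exists_prod_map_letter_eq (X : ι → A) (l : List (Option ι)) :
    ∃ l' : List ι, l'.length ≤ l.length ∧ (l.map (letter X)).prod = (l'.map X).prod := by
  induction l with
  | nil => exact ⟨[], le_rfl, rfl⟩
  | cons o l ih =>
    obtain ⟨l', h, e⟩ := ih
    cases o with
    | none => exact ⟨l', by simp; lia, by simp [letter, e]⟩
    | some i => exact ⟨i :: l', by simpa using h, by simp [letter, e]⟩

/-- If commutators of letters have degree at most one, permuting the letters of a product changes
it by terms of lower degree only. -/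
theorem prod_map_sub_mem_of_perm {X : ι → A}
    (hX : ∀ i j, X i * X j - X j * X i ∈ letterSpan R X) {l l' : List ι} (h : l.Perm l') :
    ∀ m, l.length ≤ m + 1 → (l.map X).prod - (l'.map X).prod ∈ letterSpan R X ^ m := by
  induction h with
  | nil => intro m _; simp
  | @cons i l l' h ih =>
    intro m hm
    rw [List.map_cons, List.map_cons, List.prod_cons, List.prod_cons, ← mul_sub]
    cases m with
    | zero =>
      obtain rfl : l = [] := List.length_eq_zero_iff.mp (by simpa using hm)
      rw [List.nil_perm.mp h]
      simp
    | succ m =>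
      rw [pow_succ']
      exact Submodule.mul_mem_mul (mem_letterSpan X i) (ih m (by simpa using hm))
  | swap i j l =>
    intro m hm
    have e : ((j :: i :: l).map X).prod - ((i :: j :: l).map X).prod
        = (X j * X i - X i * X j) * (l.map X).prod := by
      simp only [List.map_cons, List.prod_cons, sub_mul, mul_assoc]
    rw [e]
    have hm' : l.length + 1 ≤ m := by simpa using hm
    refine letterSpan_pow_mono X hm' ?_
    rw [pow_succ']
    exact Submodule.mul_mem_mul (hX j i) (prod_map_mem_letterSpan_pow X l)
  | trans h₁ _ ih₁ ih₂ =>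
    intro m hm
    have := add_mem (ih₁ m hm) (ih₂ m (h₁.length_eq ▸ hm))
    rwa [sub_add_sub_cancel] at this

/-- A product of more than `card ι * (p - 1)` letters repeats one of them `p` times; moving these
together and using that `p`-th powers of letters have degree at most one lowers the degree. -/
theorem letterSpan_pow_succ_le [Fintype ι] {p : ℕ} (hp : 2 ≤ p) {X : ι → A}
    (hX : ∀ i j, X i * X j - X j * X i ∈ letterSpan R X)
    (hXp : ∀ i, X i ^ p ∈ letterSpan R X) :
    letterSpan R X ^ (Fintype.card ι * (p - 1) + 1) ≤
      letterSpan R X ^ (Fintype.card ι * (p - 1)) := by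
  classical
  set N := Fintype.card ι * (p - 1) with hN
  rw [letterSpan_pow_eq_span_word X (N + 1), Submodule.span_le]
  rintro _ ⟨w, rfl⟩
  obtain ⟨l, hl, e⟩ := exists_prod_map_letter_eq X (List.ofFn w)
  rw [List.map_ofFn] at e
  change (List.ofFn (letter X ∘ w)).prod ∈ letterSpan R X ^ N
  rw [e]
  rw [List.length_ofFn] at hl
  obtain hl | hl := Nat.lt_or_ge N l.length
  swap
  · exact letterSpan_pow_mono X hl (prod_map_mem_letterSpan_pow X l)
  obtain ⟨i, hi⟩ : ∃ i, p ≤ l.count i := by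
    by_contra! hc
    have h1 : ∑ i, l.count i = l.length := by
      simpa using Multiset.sum_count_eq_card (s := Finset.univ) (m := (l : Multiset ι)) (by simp)
    have h2 : ∑ i, l.count i ≤ ∑ _i : ι, (p - 1) :=
      Finset.sum_le_sum fun i _ => Nat.le_sub_one_of_lt (hc i)
    rw [Finset.sum_const, Finset.card_univ, smul_eq_mul] at h2
    lia
  obtain ⟨l', hl'⟩ := (List.replicate_sublist_iff.mpr hi).exists_perm_append
  have h1 := prod_map_sub_mem_of_perm (R := R) hX hl' N (by lia)
  have hlen : l.length = p + l'.length := by rw [hl'.length_eq]; simp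
  have h2 : ((List.replicate p i ++ l').map X).prod ∈ letterSpan R X ^ N := by
    rw [List.map_append, List.prod_append, List.map_replicate, List.prod_replicate]
    refine letterSpan_pow_mono X (show l'.length + 1 ≤ N by lia) ?_
    rw [pow_succ']
    exact Submodule.mul_mem_mul (hXp i) (prod_map_mem_letterSpan_pow X l')
  simpa using add_mem h1 h2

end Straightening

/-! ### Representations with a given `p`-character -/

section Representations

variable {K L : Type*} [Field K] [LieRing L] [LieAlgebra K L]

/-- `ρ` is a representation of the Lie algebra `L` over `K` in the associative algebra `A` over the
commutative `K`-algebra `R`, with `p`-character `c : L → R`: it satisfies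
`ρ(x)^p - ρ(x^[p]) = c(x)^p`. Linearity over `K` is spelled out so that `A` need not carry a
`K`-module structure of its own. -/
structure IsReducedRep (K : Type*) {L R A : Type*} [Field K] [LieRing L] [LieAlgebra K L]
    [CommRing R] [Algebra K R] [Ring A] [Algebra R A] (p : ℕ) (pm : L → L) (c : L → R)
    (ρ : L → A) : Prop where
  map_add (x y : L) : ρ (x + y) = ρ x + ρ y
  map_smul (a : K) (x : L) : ρ (a • x) = algebraMap K R a • ρ x
  map_lie (x y : L) : ρ ⁅x, y⁆ = ρ x * ρ y - ρ y * ρ x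
  map_pow (x : L) : ρ x ^ p = ρ (pm x) + algebraMap R A (c x ^ p)

namespace IsReducedRep

variable {R A R' A' : Type*} [CommRing R] [Algebra K R] [Ring A] [Algebra R A]
  [CommRing R'] [Algebra K R'] [Ring A'] [Algebra R' A'] {p : ℕ} {pm : L → L}

theorem map {c : L → R} {ρ : L → A} (h : IsReducedRep K p pm c ρ) (φ : R →ₐ[K] R') (f : A →+* A')
    (hf : ∀ r, f (algebraMap R A r) = algebraMap R' A' (φ r)) :
    IsReducedRep K p pm (fun x => φ (c x)) (fun x => f (ρ x)) where
  map_add x y := by rw [h.map_add, _root_.map_add]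
  map_smul a x := by
    rw [h.map_smul, Algebra.smul_def, map_mul, hf, Algebra.smul_def, φ.commutes]
  map_lie x y := by rw [h.map_lie, map_sub, map_mul, map_mul]
  map_pow x := by rw [← _root_.map_pow, h.map_pow, _root_.map_add, hf, _root_.map_pow]

theorem map_algHom {A' : Type*} [Ring A'] [Algebra R A'] {c : L → R} {ρ : L → A}
    (h : IsReducedRep K p pm c ρ) (f : A →ₐ[R] A') :
    IsReducedRep K p pm c (fun x => f (ρ x)) :=
  h.map (AlgHom.id K R) (f : A →+* A') f.commutes

/-- A family of maps is a representation if it becomes one along each of a jointly injective family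
of ring homomorphisms. -/
theorem of_forall_map {J : Type*} {S B : J → Type*} [∀ i, CommRing (S i)]
    [∀ i, Algebra K (S i)] [∀ i, Ring (B i)] [∀ i, Algebra (S i) (B i)] {c : L → R} {ρ : L → A}
    (φ : ∀ i, R →ₐ[K] S i) (f : ∀ i, A →+* B i)
    (hf : ∀ i r, f i (algebraMap R A r) = algebraMap (S i) (B i) (φ i r))
    (inj : ∀ a b, (∀ i, f i a = f i b) → a = b)
    (h : ∀ i, IsReducedRep K p pm (fun x => φ i (c x)) (fun x => f i (ρ x))) :
    IsReducedRep K p pm c ρ where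
  map_add x y := inj _ _ fun i => by rw [(h i).map_add, _root_.map_add]
  map_smul a x := inj _ _ fun i => by
    rw [(h i).map_smul, Algebra.smul_def, Algebra.smul_def, map_mul, hf, (φ i).commutes]
  map_lie x y := inj _ _ fun i => by rw [(h i).map_lie, map_sub, map_mul, map_mul]
  map_pow x := inj _ _ fun i => by
    rw [_root_.map_pow, (h i).map_pow, _root_.map_add, hf, _root_.map_pow (φ i)]

/-- A representation whose `p`-character takes values in `R` is a representation over `R`. -/
theorem restrictScalars [Algebra R R'] [IsScalarTower K R R'] [Algebra R A']
    [IsScalarTower R R' A'] {c : L → R} {ρ : L → A'}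
    (h : IsReducedRep K p pm (fun x => algebraMap R R' (c x)) ρ) : IsReducedRep K p pm c ρ where
  map_add := h.map_add
  map_smul a x := by
    rw [h.map_smul, IsScalarTower.algebraMap_apply K R R', algebraMap_smul]
  map_lie := h.map_lie
  map_pow x := by
    rw [h.map_pow, IsScalarTower.algebraMap_apply R R' A', _root_.map_pow (algebraMap R R')]

variable {c : L → R} {ρ : L → A} {ι : Type*} (b : Basis ι K L)
include b

theorem mem_span (h : IsReducedRep K p pm c ρ) (x : L) :
    ρ x ∈ Submodule.span R (Set.range fun i => ρ (b i)) := by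
  induction b.mem_span x using Submodule.span_induction with
  | mem y hy =>
    obtain ⟨i, rfl⟩ := hy
    exact Submodule.subset_span ⟨i, rfl⟩
  | zero =>
    have : ρ 0 = 0 := by simpa using h.map_smul 0 0
    rw [this]; exact zero_mem _
  | add x y _ _ hx hy => rw [h.map_add]; exact add_mem hx hy
  | smul a x _ hx => rw [h.map_smul]; exact Submodule.smul_mem _ _ hx

theorem mem_letterSpan (h : IsReducedRep K p pm c ρ) (x : L) :
    ρ x ∈ letterSpan R fun i => ρ (b i) := by
  refine Submodule.span_mono ?_ (h.mem_span b x)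
  rintro _ ⟨i, rfl⟩
  exact ⟨some i, rfl⟩

theorem mul_mem_letterSpan_pow [Fintype ι] (hp : 2 ≤ p) (h : IsReducedRep K p pm c ρ) (x : L)
    {y : A} (hy : y ∈ letterSpan R (fun i => ρ (b i)) ^ (Fintype.card ι * (p - 1))) :
    ρ x * y ∈ letterSpan R (fun i => ρ (b i)) ^ (Fintype.card ι * (p - 1)) := by
  refine letterSpan_pow_succ_le hp (fun i j => ?_) (fun i => ?_) ?_
  · rw [← h.map_lie]; exact h.mem_letterSpan b _
  · rw [h.map_pow]
    refine add_mem (h.mem_letterSpan b _) ?_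
    exact one_le_letterSpan _ (Submodule.algebraMap_mem _)
  · rw [pow_succ']
    exact Submodule.mul_mem_mul (h.mem_letterSpan b x) hy

end IsReducedRep

/-- Matrices `ρ`, a vector `v` and coefficients `a` over `R` exhibiting `R^e` as a representation of
`L` with `p`-character `c`, generated by `v`, with `ρ(x) v = t v` for all `(x, t) ∈ C`. That `v`
generates is witnessed by the coefficients `a`, which express the standard basis vectors through
the images of `v` under words in the `ρ (b i)`; so all conditions are polynomial equations over `K`
and pass along homomorphisms of `K`-algebras. -/
structure IsCyclicDatum {R ι : Type*} [CommRing R] [Algebra K R] [Fintype ι] (p : ℕ) (pm : L → L)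
    (b : ι → L) (C : Set (L × K)) (c : L → R) {N e : ℕ} (ρ : L → Matrix (Fin e) (Fin e) R)
    (v : Fin e → R) (a : (Fin N → Option ι) → Fin e → R) : Prop where
  rep : IsReducedRep K p pm c ρ
  eigen (x : L) (t : K) : (x, t) ∈ C → (ρ x).mulVec v = algebraMap K R t • v
  gen (i j : Fin e) :
    ∑ w, a w j * (word (fun i => ρ (b i)) w).mulVec v i = (1 : Matrix (Fin e) (Fin e) R) i j

namespace IsCyclicDatum

variable {R R' ι : Type*} [CommRing R] [Algebra K R] [CommRing R'] [Algebra K R'] [Fintype ι]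
  {p : ℕ} {pm : L → L} {b : ι → L} {C : Set (L × K)} {c : L → R} {N e : ℕ}
  {ρ : L → Matrix (Fin e) (Fin e) R} {v : Fin e → R} {a : (Fin N → Option ι) → Fin e → R}

theorem mulVec_mapMatrix (φ : R →+* R') (M : Matrix (Fin e) (Fin e) R) (v : Fin e → R) (i : Fin e) :
    (φ.mapMatrix M).mulVec (fun i => φ (v i)) i = φ (M.mulVec v i) :=
  (RingHom.map_mulVec φ M v i).symm

theorem mapMatrix_algebraMap (φ : R →+* R') (r : R) :
    φ.mapMatrix (algebraMap R (Matrix (Fin e) (Fin e) R) r) =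
      algebraMap R' (Matrix (Fin e) (Fin e) R') (φ r) := by
  ext i j
  simp only [RingHom.mapMatrix_apply, Matrix.map_apply, Matrix.algebraMap_matrix_apply]
  split_ifs <;> simp

theorem map (h : IsCyclicDatum p pm b C c ρ v a) (φ : R →ₐ[K] R') :
    IsCyclicDatum p pm b C (fun x => φ (c x)) (fun x => (φ : R →+* R').mapMatrix (ρ x))
      (fun i => φ (v i)) (fun w j => φ (a w j)) where
  rep := h.rep.map φ _ fun r => mapMatrix_algebraMap _ r
  eigen x t hx := by
    funext i
    refine (mulVec_mapMatrix (φ : R →+* R') (ρ x) v i).trans ?_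
    rw [h.eigen x t hx]
    simp
  gen i j := by
    have h1 := congrArg φ (h.gen i j)
    rw [map_sum] at h1
    simp only [map_mul] at h1
    rw [← (φ : R →+* R').mapMatrix.map_one, RingHom.mapMatrix_apply, Matrix.map_apply]
    refine Eq.trans (Finset.sum_congr rfl fun w _ => ?_) h1
    rw [← map_word]
    congr 1
    exact mulVec_mapMatrix (φ : R →+* R') _ v i

/-- Data that satisfy the conditions along each of a jointly injective family of homomorphisms
satisfy them. -/
theorem of_forall_map {J : Type*} {S : J → Type*} [∀ k, CommRing (S k)] [∀ k, Algebra K (S k)]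
    (φ : ∀ k, R →ₐ[K] S k) (inj : ∀ r s, (∀ k, φ k r = φ k s) → r = s)
    (h : ∀ k, IsCyclicDatum p pm b C (fun x => φ k (c x))
      (fun x => (φ k : R →+* S k).mapMatrix (ρ x)) (fun i => φ k (v i)) (fun w j => φ k (a w j))) :
    IsCyclicDatum p pm b C c ρ v a where
  rep := IsReducedRep.of_forall_map φ (fun k => (φ k : R →+* S k).mapMatrix)
    (fun k r => mapMatrix_algebraMap _ r)
    (fun A B hAB => Matrix.ext fun i j => inj _ _ fun k => congrFun (congrFun (hAB k) i) j)
    (fun k => (h k).rep)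
  eigen x t hx := funext fun i => inj _ _ fun k => by
    refine (mulVec_mapMatrix (φ k : R →+* S k) (ρ x) v i).symm.trans ?_
    refine (congrFun ((h k).eigen x t hx) i).trans ?_
    simp
  gen i j := inj _ _ fun k => by
    rw [map_sum]
    simp only [map_mul]
    have h1 := (h k).gen i j
    rw [← (φ k : R →+* S k).mapMatrix.map_one, RingHom.mapMatrix_apply, Matrix.map_apply] at h1
    refine Eq.trans (Finset.sum_congr rfl fun w _ => ?_) h1
    rw [← map_word]
    congr 1
    exact (mulVec_mapMatrix (φ k : R →+* S k) _ v i).symm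

theorem span_eq_top (h : IsCyclicDatum p pm b C c ρ v a) :
    Submodule.span R
      (Set.range fun w : Fin N → Option ι => (word (fun i => ρ (b i)) w).mulVec v) = ⊤ := by
  rw [eq_top_iff, ← (Pi.basisFun R (Fin e)).span_eq, Submodule.span_le]
  rintro _ ⟨j, rfl⟩
  refine (Submodule.mem_span_range_iff_exists_fun R).mpr ⟨fun w => a w j, funext fun i => ?_⟩
  rw [Finset.sum_apply, Pi.basisFun_apply, Pi.single_apply, ← Matrix.one_apply, ← h.gen i j]
  rfl

end IsCyclicDatum

/-- A free module of rank `e` that is a cyclic representation yields matrix data. -/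
theorem exists_isCyclicDatum_of_basis {R Q ι : Type*} [CommRing R] [Algebra K R] [AddCommGroup Q]
    [Module R Q] [Fintype ι] {p : ℕ} {pm : L → L} {b : ι → L} {C : Set (L × K)} {c : L → R}
    {N e : ℕ} (B : Basis (Fin e) R Q) {ρ : L → Module.End R Q} {v : Q}
    (h : IsReducedRep K p pm c ρ) (hC : ∀ x t, (x, t) ∈ C → ρ x v = algebraMap K R t • v)
    (hv : Submodule.span R
      (Set.range fun w : Fin N → Option ι => word (fun i => ρ (b i)) w v) = ⊤) :
    ∃ (M : L → Matrix (Fin e) (Fin e) R) (v' : Fin e → R) (a : (Fin N → Option ι) → Fin e → R),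
      IsCyclicDatum p pm b C c M v' a := by
  have ha (j : Fin e) : ∃ a : (Fin N → Option ι) → R,
      ∑ w, a w • word (fun i => ρ (b i)) w v = B j :=
    Submodule.mem_span_range_iff_exists_fun R |>.mp (hv ▸ Submodule.mem_top)
  choose a ha using ha
  let f : Module.End R Q →ₐ[R] Matrix (Fin e) (Fin e) R := (LinearMap.toMatrixAlgEquiv B).toAlgHom
  have hf (g : Module.End R Q) (y : Q) : (f g).mulVec (B.repr y) = B.repr (g y) :=
    LinearMap.toMatrix_mulVec_repr B B g y
  refine ⟨fun x => f (ρ x), B.repr v, fun w j => a j w,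
    h.map_algHom f, fun x t hx => ?_,
    fun i j => ?_⟩
  · rw [hf, hC x t hx]
    simp
  · have e1 := congrArg (fun y => B.repr y i) (ha j)
    simp only [map_sum, map_smul, Finsupp.coe_finsetSum, Finset.sum_apply, Finsupp.smul_apply,
      smul_eq_mul, B.repr_self] at e1
    rw [Finsupp.single_apply] at e1
    rw [Matrix.one_apply, if_congr (eq_comm (a := i)) rfl rfl, ← e1]
    refine Finset.sum_congr rfl fun w _ => ?_
    rw [← hf]
    congr 3
    exact (map_word (f : Module.End R Q →+* Matrix (Fin e) (Fin e) R) _ w).symm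

end Representations

/-! ### Specialisation of cyclic representations -/

section Specialisation

variable {K L ι : Type*} [Field K] [LieRing L] [LieAlgebra K L] [Fintype ι] {p : ℕ}
  {pm : L → L} {C : Set (L × K)} {e : ℕ}

/-- Over the fraction field `F` of a valuation ring `O`, a cyclic representation whose `p`-character
takes values in `O` has a stable lattice: the `O`-span of the images of the generator under words is
finitely generated by straightening, and torsion free, hence free. -/
theorem exists_isCyclicDatum_of_valuationRing {O F : Type*} [CommRing O] [IsDomain O]
    [ValuationRing O] [Field F] [Algebra O F] [IsFractionRing O F] [Algebra K O] [Algebra K F]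
    [IsScalarTower K O F] (hp : 2 ≤ p) (b : Basis ι K L) {c : L → O}
    {ρ : L → Matrix (Fin e) (Fin e) F} {v : Fin e → F}
    {a : (Fin (Fintype.card ι * (p - 1)) → Option ι) → Fin e → F}
    (h : IsCyclicDatum p pm b C (fun x => algebraMap O F (c x)) ρ v a) :
    ∃ (M : L → Matrix (Fin e) (Fin e) O) (v' : Fin e → O)
      (a' : (Fin (Fintype.card ι * (p - 1)) → Option ι) → Fin e → O),
      IsCyclicDatum p pm b C c M v' a' := by
  have hρ : IsReducedRep K p pm c ρ := h.rep.restrictScalars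
  let ev : Matrix (Fin e) (Fin e) F →ₗ[O] (Fin e → F) :=
    { toFun := fun y => y.mulVec v
      map_add' := fun y z => Matrix.add_mulVec y z v
      map_smul' := fun r y => Matrix.smul_mulVec r y v }
  let N := Fintype.card ι * (p - 1)
  let gens : (Fin N → Option ι) → (Fin e → F) := fun w => (word (fun i => ρ (b i)) w).mulVec v
  let M : Submodule O (Fin e → F) := Submodule.span O (Set.range gens)
  have hM : M = (letterSpan O (fun i => ρ (b i)) ^ N).map ev := by
    rw [letterSpan_pow_eq_span_word, Submodule.map_span, ← Set.range_comp]
    rfl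
  -- The stabiliser of the lattice `M`; `ρ` takes values in it, and it acts on `M`.
  let S : Subalgebra O (Matrix (Fin e) (Fin e) F) :=
    { carrier := {y | ∀ m ∈ M, y.mulVec m ∈ M}
      mul_mem' := fun {y z} hy hz m hm => by
        rw [← Matrix.mulVec_mulVec]; exact hy _ (hz _ hm)
      add_mem' := fun {y z} hy hz m hm => by
        rw [Matrix.add_mulVec]; exact add_mem (hy _ hm) (hz _ hm)
      algebraMap_mem' := fun r m hm => by
        rw [Algebra.algebraMap_eq_smul_one, Matrix.smul_mulVec, Matrix.one_mulVec]
        exact M.smul_mem r hm }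
  have hρS (x : L) : ρ x ∈ S := by
    intro m hm
    rw [hM] at hm ⊢
    obtain ⟨y, hy, rfl⟩ := hm
    exact ⟨ρ x * y, hρ.mul_mem_letterSpan_pow b hp x hy, (Matrix.mulVec_mulVec v (ρ x) y).symm⟩
  let toEnd : S →ₐ[O] Module.End O M := AlgHom.ofLinearMap
    { toFun := fun y =>
        { toFun := fun m => ⟨y.1.mulVec m, y.2 m m.2⟩
          map_add' := fun m m' => Subtype.ext (Matrix.mulVec_add y.1 m m')
          map_smul' := fun r m => Subtype.ext (Matrix.mulVec_smul y.1 r m.1) }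
      map_add' := fun y z => LinearMap.ext fun m => Subtype.ext (Matrix.add_mulVec y.1 z.1 m)
      map_smul' := fun r y => LinearMap.ext fun m => Subtype.ext (Matrix.smul_mulVec r y.1 m) }
    (LinearMap.ext fun m => Subtype.ext (Matrix.one_mulVec m.1))
    (fun y z => LinearMap.ext fun m => Subtype.ext (Matrix.mulVec_mulVec m.1 y.1 z.1).symm)
  have hrepS : IsReducedRep K p pm c fun x => (⟨ρ x, hρS x⟩ : S) :=
    IsReducedRep.of_forall_map (J := Unit) (fun _ => AlgHom.id K O)
      (fun _ => (S.val : S →+* Matrix (Fin e) (Fin e) F)) (fun _ _ => rfl)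
      (fun y z hyz => Subtype.ext (hyz ())) (fun _ => hρ)
  have hrep : IsReducedRep K p pm c fun x => toEnd ⟨ρ x, hρS x⟩ :=
    hrepS.map_algHom (A' := Module.End O M) toEnd
  have hword (w : Fin N → Option ι) (m : M) :
      (word (fun i => toEnd ⟨ρ (b i), hρS (b i)⟩) w m : Fin e → F) =
        (word (fun i => ρ (b i)) w).mulVec m := by
    have h1 := map_word (toEnd : S →+* Module.End O M) (fun i => ⟨ρ (b i), hρS (b i)⟩) w
    have h2 := map_word (S.val : S →+* Matrix (Fin e) (Fin e) F)
      (fun i => ⟨ρ (b i), hρS (b i)⟩) w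
    exact (congrArg (fun g : Module.End O M => (g m : Fin e → F)) h1.symm).trans
      (congrArg (fun g : Matrix (Fin e) (Fin e) F => g.mulVec (m : Fin e → F)) h2)
  have hvM : v ∈ M := by
    refine Submodule.subset_span ⟨fun _ => none, ?_⟩
    simp [gens, word, letter]
  have : Module.Finite O M := Module.Finite.span_of_finite O (Set.finite_range gens)
  have : Module.Flat O M := by
    rw [Module.Flat.flat_iff_torsion_eq_bot_of_isBezout,
      ← Submodule.isTorsionFree_iff_torsion_eq_bot]
    infer_instance
  have : Module.Free O M := Module.free_of_flat_of_isLocalRing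
  let B₀ := Module.Free.chooseBasis O M
  have hli : LinearIndependent F fun i => (B₀ i : Fin e → F) :=
    (LinearIndependent.iff_fractionRing O F).mp
      (B₀.linearIndependent.map' M.subtype (Submodule.ker_subtype M))
  have hspan : ⊤ ≤ Submodule.span F (Set.range fun i => (B₀ i : Fin e → F)) := by
    have h1 : (M : Set (Fin e → F)) ⊆ Submodule.span F (Set.range fun i => (B₀ i : Fin e → F)) := by
      intro m hm
      have h2 : (⟨m, hm⟩ : M) ∈ Submodule.span O (Set.range B₀) := B₀.mem_span _
      have h3 := Submodule.mem_map_of_mem (f := M.subtype) h2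
      rw [Submodule.map_span, ← Set.range_comp] at h3
      exact Submodule.span_le_restrictScalars O F _ h3
    rw [← h.span_eq_top, Submodule.span_le]
    exact Submodule.subset_span.trans h1
  have hcard : Fintype.card (Module.Free.ChooseBasisIndex O M) = e := by
    rw [← Module.finrank_eq_card_basis (Basis.mk hli hspan), Module.finrank_fin_fun]
  refine exists_isCyclicDatum_of_basis (B₀.reindex (Fintype.equivFinOfCardEq hcard)) hrep
    (v := ⟨v, hvM⟩) (fun x t hx => Subtype.ext ?_) ?_
  · refine (h.eigen x t hx).trans ?_
    rw [IsScalarTower.algebraMap_apply K O F, algebraMap_smul]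
    rfl
  · apply Submodule.map_injective_of_injective M.injective_subtype
    rw [Submodule.map_span, ← Set.range_comp, Submodule.map_top, Submodule.range_subtype]
    refine congrArg (fun g => Submodule.span O (Set.range g)) (funext fun w => ?_)
    exact hword w _

/-- Over an algebraically closed field `K`, polynomial equations over `K` that are solvable in an
extension field are solvable in `K`; here this is applied to the equations for a cyclic
representation. -/
theorem exists_isCyclicDatum_of_extension [IsAlgClosed K] {k : Type*} [Field k] [Algebra K k]
    (b : Basis ι K L) {χ : L → K} {N : ℕ} {ρ : L → Matrix (Fin e) (Fin e) k} {v : Fin e → k}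
    {a : (Fin N → Option ι) → Fin e → k}
    (h : IsCyclicDatum p pm b C (fun x => algebraMap K k (χ x)) ρ v a) :
    ∃ (M : L → Matrix (Fin e) (Fin e) K) (v' : Fin e → K) (a' : (Fin N → Option ι) → Fin e → K),
      IsCyclicDatum p pm b C χ M v' a' := by
  let s : Set k := (Set.range fun q : ι × Fin e × Fin e => ρ (b q.1) q.2.1 q.2.2) ∪
    (Set.range v ∪ Set.range fun q : (Fin N → Option ι) × Fin e => a q.1 q.2)
  have hs : s.Finite :=
    (Set.finite_range _).union ((Set.finite_range _).union (Set.finite_range _))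
  -- A finitely generated algebra over which the data are defined.
  let R : Subalgebra K k := Algebra.adjoin K s
  have hRft : Algebra.FiniteType K R :=
    (Subalgebra.fg_iff_finiteType R).mp ⟨hs.toFinset, by rw [hs.coe_toFinset]⟩
  have hρ (x : L) (i j : Fin e) : ρ x i j ∈ R := by
    have h1 : IsReducedRep K p pm χ ρ := h.rep.restrictScalars
    have h2 := h1.mem_span b x
    generalize ρ x = y at h2 ⊢
    induction h2 using Submodule.span_induction with
    | mem y hy =>
      obtain ⟨q, rfl⟩ := hy
      exact Algebra.subset_adjoin (Or.inl ⟨(q, i, j), rfl⟩)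
    | zero => exact zero_mem _
    | add y z _ _ hy hz => exact add_mem hy hz
    | smul t y _ hy => exact R.smul_mem hy t
  have hv (i : Fin e) : v i ∈ R := Algebra.subset_adjoin (Or.inr (Or.inl ⟨i, rfl⟩))
  have ha (w : Fin N → Option ι) (j : Fin e) : a w j ∈ R :=
    Algebra.subset_adjoin (Or.inr (Or.inr ⟨(w, j), rfl⟩))
  have hR : IsCyclicDatum p pm b C (fun x => algebraMap K R (χ x))
      (fun x => Matrix.of fun i j => (⟨ρ x i j, hρ x i j⟩ : R)) (fun i => ⟨v i, hv i⟩)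
      (fun w j => ⟨a w j, ha w j⟩) :=
    IsCyclicDatum.of_forall_map (J := Unit) (fun _ => R.val)
      (fun r s hrs => Subtype.ext (hrs ())) (fun _ => h)
  obtain ⟨m, hm⟩ := Ideal.exists_maximal R
  let _ : Field (R ⧸ m) := Ideal.Quotient.field m
  have : Algebra.FiniteType K (R ⧸ m) := inferInstance
  have : Module.Finite K (R ⧸ m) := finite_of_finite_type_of_isJacobsonRing K (R ⧸ m)
  let ψ : R →ₐ[K] K :=
    (AlgEquiv.ofBijective (Algebra.ofId K (R ⧸ m))
      IsAlgClosed.algebraMap_bijective_of_isIntegral).symm.toAlgHom.comp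
      (Ideal.Quotient.mkₐ K m)
  have := hR.map ψ
  simp only [AlgHom.commutes] at this
  exact ⟨_, _, _, this⟩

end Specialisation

/-! ### Closedness of the existence locus -/

section Closedness

/-- If the kernel of a ring homomorphism `ψ` into a field is contained in the kernel of `ev`, there
is a valuation ring of that field containing the image of `ψ` and centred on the kernel of `ev`. -/
theorem exists_valuationSubring_of_ker_le {P F S : Type*} [CommRing P] [Field F] [Ring S]
    [Nontrivial S] (ψ : P →+* F) (ev : P →+* S) (h : ∀ f, ψ f = 0 → ev f = 0) :
    ∃ O : ValuationSubring F, (∀ f, ψ f ∈ O) ∧ ∀ f, ev f = 0 → ψ f ∈ O.nonunits := by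
  have hI : (RingHom.ker ev).map ψ.rangeRestrict ≠ ⊤ := by
    rw [Ne, Ideal.eq_top_iff_one,
      Ideal.mem_map_iff_of_surjective _ ψ.rangeRestrict_surjective]
    rintro ⟨f, hf, h1⟩
    have h2 : ψ f = 1 := congrArg Subtype.val h1
    have h3 := h (1 - f) (by rw [map_sub, map_one, h2, sub_self])
    rw [map_sub, map_one, (RingHom.mem_ker).mp hf, sub_zero] at h3
    exact one_ne_zero h3
  obtain ⟨O, hO, hOI⟩ := Ideal.image_subset_nonunits_valuationSubring _ hI
  exact ⟨O, fun f => hO ⟨f, rfl⟩, fun f hf =>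
    hOI ⟨ψ.rangeRestrict f, Ideal.mem_map_of_mem _ hf, rfl⟩⟩

variable {K L ι V : Type*} [Field K] [IsAlgClosed K] [LieRing L] [LieAlgebra K L] [Fintype ι]
  {p : ℕ} {pm : L → L} {C : Set (L × K)} {e : ℕ} [AddCommGroup V] [Module K V]

variable (p pm C e) in
/-- There is an `e`-dimensional cyclic representation over `K` with `p`-character `χ`. -/
def HasCyclicDatum (b : Basis ι K L) (χ : L → K) : Prop :=
  ∃ (ρ : L → Matrix (Fin e) (Fin e) K) (v : Fin e → K)
    (a : (Fin (Fintype.card ι * (p - 1)) → Option ι) → Fin e → K), IsCyclicDatum p pm b C χ ρ v a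

/-- Specialisation of cyclic representations: if `ev` is a specialisation of the point `ψ` of
`Spec P`, a cyclic representation over the field `F` with `p`-character `ψ ∘ c` implies one over `K`
with `p`-character `ev ∘ c`. -/
theorem hasCyclicDatum_of_ker_le (hp : 2 ≤ p) (b : Basis ι K L) {P F : Type*} [CommRing P]
    [Algebra K P] [Field F] [Algebra K F] (ψ : P →ₐ[K] F) (ev : P →ₐ[K] K)
    (hker : ∀ f, ψ f = 0 → ev f = 0) (c : L → P) {ρ : L → Matrix (Fin e) (Fin e) F} {v : Fin e → F}
    {a : (Fin (Fintype.card ι * (p - 1)) → Option ι) → Fin e → F}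
    (h : IsCyclicDatum p pm b C (fun x => ψ (c x)) ρ v a) :
    HasCyclicDatum p pm C e b fun x => ev (c x) := by
  obtain ⟨O, hmem, hO⟩ := exists_valuationSubring_of_ker_le (ψ : P →+* F) (ev : P →+* K) hker
  let _ : Algebra K O := ((algebraMap K F).codRestrict O.toSubring fun t => by
    rw [← ψ.commutes t]; exact hmem _).toAlgebra
  have : IsScalarTower K O F := IsScalarTower.of_algebraMap_eq fun _ => rfl
  let cO : L → O := fun x => ⟨ψ (c x), hmem _⟩
  obtain ⟨ρ', v', a', hd⟩ := exists_isCyclicDatum_of_valuationRing (O := O) (c := cO) hp b h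
  let k := IsLocalRing.ResidueField O
  have hk := hd.map (IsScalarTower.toAlgHom K O k)
  have hck (x : L) : IsScalarTower.toAlgHom K O k (cO x) = algebraMap K k (ev (c x)) := by
    have h1 : cO x - algebraMap K O (ev (c x)) ∈ IsLocalRing.maximalIdeal O := by
      have h2 := hO (c x - algebraMap K P (ev (c x))) (by simp)
      obtain ⟨y, hy⟩ := (ValuationSubring.mem_nonunits_iff_exists_mem_maximalIdeal).mp h2
      convert hy
      change ψ (c x) - algebraMap K F (ev (c x)) = ψ (c x - algebraMap K P (ev (c x)))
      rw [map_sub, ψ.commutes]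
    have h4 := (IsLocalRing.residue_eq_zero_iff _).mpr h1
    rw [map_sub, sub_eq_zero] at h4
    exact h4
  simp only [hck] at hk
  exact exists_isCyclicDatum_of_extension b hk

/-- The `p`-characters of `e`-dimensional cyclic representations form a Zariski closed set: every
point `μ₀` of the closure belongs to it. -/
theorem hasCyclicDatum_of_forall_eval_ne_zero (hp : 2 ≤ p) (b : Basis ι K L)
    (m : V →ₗ[K] Dual K L) (μ₀ : V)
    (h : ∀ f : MvPolynomial (Dual K V) K, MvPolynomial.eval (fun l => l μ₀) f ≠ 0 →
      ∃ μ, HasCyclicDatum p pm C e b (m μ) ∧ MvPolynomial.eval (fun l => l μ) f ≠ 0) :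
    HasCyclicDatum p pm C e b (m μ₀) := by
  let E := {μ : V // HasCyclicDatum p pm C e b (m μ)}
  let P := E → K
  choose ρ v a hd using fun μ : E => μ.2
  -- The data over all points of `E` together are data over the ring of functions on `E`.
  have hP : IsCyclicDatum p pm b C (fun x => (fun μ => m μ.1 x : P))
      (fun x => Matrix.of fun i j => (fun μ => ρ μ x i j : P)) (fun i => (fun μ => v μ i : P))
      (fun w j => (fun μ => a μ w j : P)) :=
    IsCyclicDatum.of_forall_map (fun μ : E => Pi.evalAlgHom K (fun _ : E => K) μ)
      (fun r s hrs => funext hrs) (fun μ => hd μ)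
  let ev : MvPolynomial (Dual K V) K →ₐ[K] P :=
    MvPolynomial.aeval fun l => (fun μ => l μ.1 : P)
  have hev (f : MvPolynomial (Dual K V) K) (μ : E) :
      ev f μ = MvPolynomial.eval (fun l => l μ.1) f := by
    have h1 : (Pi.evalAlgHom K (fun _ : E => K) μ).comp ev =
        MvPolynomial.aeval fun l : Dual K V => l μ.1 := by
      ext l; simp [ev]
    exact (DFunLike.congr_fun h1 f).trans (by rw [MvPolynomial.aeval_eq_eval])
  let ev₀ : MvPolynomial (Dual K V) K →+* K := MvPolynomial.eval fun l : Dual K V => l μ₀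
  -- The functions that come from polynomials not vanishing at `μ₀`; a prime ideal avoids them.
  let S : Submonoid P := ((nonZeroDivisors K).comap ev₀).map (ev : MvPolynomial (Dual K V) K →+* P)
  have hS : Disjoint ((⊥ : Ideal P) : Set P) S := by
    rw [Set.disjoint_left]
    rintro _ h0 ⟨f, hf, rfl⟩
    obtain ⟨μ, hμ, hne⟩ := h f (nonZeroDivisors.ne_zero hf)
    exact hne ((hev f ⟨μ, hμ⟩).symm.trans (congrFun (show ev f = 0 from h0) ⟨μ, hμ⟩))
  obtain ⟨q, hq, -, hqS⟩ := Ideal.exists_le_prime_disjoint ⊥ S hS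
  let F := FractionRing (P ⧸ q)
  let φ : P →ₐ[K] F := (IsScalarTower.toAlgHom K (P ⧸ q) F).comp (Ideal.Quotient.mkₐ K q)
  have hφ (r : P) (hr : φ r = 0) : r ∈ q := by
    have h1 : algebraMap (P ⧸ q) F (Ideal.Quotient.mk q r) = 0 := hr
    rw [← Ideal.Quotient.eq_zero_iff_mem]
    exact IsFractionRing.injective (P ⧸ q) F (h1.trans (map_zero _).symm)
  have hψ (f : MvPolynomial (Dual K V) K) (hf : ev₀ f ≠ 0) : φ (ev f) ≠ 0 := fun h0 =>
    Set.disjoint_left.mp hqS (hφ _ h0) ⟨f, mem_nonZeroDivisors_of_ne_zero hf, rfl⟩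
  have hc (x : L) : (fun μ => m μ.1 x : P) = ev (MvPolynomial.X (m.flip x)) := by
    funext μ
    rw [hev, MvPolynomial.eval_X]
    rfl
  have hF := hP.map φ
  simp only [hc] at hF
  have := hasCyclicDatum_of_ker_le hp b (φ.comp ev) (MvPolynomial.aeval fun l : Dual K V => l μ₀)
    (fun f hf => by
      rw [MvPolynomial.aeval_eq_eval]
      exact not_not.mp fun h0 => hψ f h0 hf) (fun x => MvPolynomial.X (m.flip x)) hF
  simpa only [MvPolynomial.aeval_X, LinearMap.flip_apply] using this

end Closedness

/-! ### Cyclic modules over reduced enveloping algebras -/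

section ReducedEnveloping

variable {K L ι : Type*} [Field K] [LieRing L] [LieAlgebra K L] [Fintype ι] {p : ℕ}
  {pm : L → L} {C : Set (L × K)} {χ : Dual K L}

variable (p pm χ) in
/-- The canonical map from `L` to its reduced enveloping algebra. -/
noncomputable def toReduced (x : L) : ReducedEnvelopingAlgebra p pm χ :=
  RingQuot.mkAlgHom K (ReducedRel p pm χ) (UniversalEnvelopingAlgebra.ι K x)

theorem isReducedRep_toReduced : IsReducedRep K p pm χ (toReduced p pm χ) where
  map_add x y := by simp only [toReduced, map_add]
  map_smul a x := by simp only [toReduced, map_smul]; rfl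
  map_lie x y := by
    simp only [toReduced, LieHom.map_lie, LieRing.of_associative_ring_bracket, map_sub, map_mul]
  map_pow x := by
    have h := RingQuot.mkAlgHom_rel K (ReducedRel.rel (p := p) (pm := pm) (χ := χ) x)
    rw [map_sub, map_pow, AlgHom.commutes, sub_eq_iff_eq_add'] at h
    exact h

theorem adjoin_range_toReduced :
    Algebra.adjoin K (Set.range (toReduced p pm χ)) = ⊤ := by
  let f : TensorAlgebra K L →ₐ[K] ReducedEnvelopingAlgebra p pm χ :=
    (RingQuot.mkAlgHom K (ReducedRel p pm χ)).comp (UniversalEnvelopingAlgebra.mkAlgHom K L)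
  have hf : Function.Surjective f :=
    (RingQuot.mkAlgHom_surjective K _).comp (RingCon.mk'_surjective _)
  have h : Set.range (toReduced p pm χ) = f '' Set.range (TensorAlgebra.ι K) := by
    rw [← Set.range_comp]
    rfl
  rw [h, ← AlgHom.map_adjoin, TensorAlgebra.adjoin_range_ι, Algebra.map_top,
    (AlgHom.range_eq_top f).mpr hf]

theorem letterSpan_toReduced_pow_eq_top (hp : 2 ≤ p) (b : Basis ι K L) :
    letterSpan K (fun i => toReduced p pm χ (b i)) ^ (Fintype.card ι * (p - 1)) = ⊤ := by
  set W := letterSpan K (fun i => toReduced p pm χ (b i)) ^ (Fintype.card ι * (p - 1))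
  have h1 : (1 : ReducedEnvelopingAlgebra p pm χ) ∈ W :=
    Submodule.one_le.mp (one_le_pow_of_one_le' (one_le_letterSpan _) _)
  have key (u : ReducedEnvelopingAlgebra p pm χ) : ∀ w ∈ W, u * w ∈ W := by
    have hu : u ∈ Algebra.adjoin K (Set.range (toReduced p pm χ)) := by
      rw [adjoin_range_toReduced]; trivial
    induction hu using Algebra.adjoin_induction with
    | mem u hu =>
      obtain ⟨x, rfl⟩ := hu
      exact fun w hw => isReducedRep_toReduced.mul_mem_letterSpan_pow b hp x hw
    | algebraMap r =>
      intro w hw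
      rw [← Algebra.smul_def]
      exact W.smul_mem r hw
    | add u u' _ _ h h' =>
      intro w hw
      rw [add_mul]
      exact add_mem (h w hw) (h' w hw)
    | mul u u' _ _ h h' =>
      intro w hw
      rw [mul_assoc]
      exact h _ (h' w hw)
  exact eq_top_iff.mpr fun u _ => by simpa using key u 1 h1

theorem finite_reducedEnvelopingAlgebra (hp : 2 ≤ p) (b : Basis ι K L) :
    Module.Finite K (ReducedEnvelopingAlgebra p pm χ) := by
  have h := letterSpan_toReduced_pow_eq_top (pm := pm) (χ := χ) hp b
  rw [letterSpan_pow_eq_span_word] at h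
  exact ⟨⟨(Set.finite_range _).toFinset, by rw [Set.Finite.coe_toFinset]; exact h⟩⟩

/-- A finite-dimensional cyclic module yields matrix data. -/
theorem hasCyclicDatum_of_cyclic (hp : 2 ≤ p) (b : Basis ι K L) {Q : Type*} [AddCommGroup Q]
    [Module K Q] [Module (ReducedEnvelopingAlgebra p pm χ) Q]
    [IsScalarTower K (ReducedEnvelopingAlgebra p pm χ) Q] [Module.Finite K Q] {v : Q}
    (hv : ∀ q : Q, ∃ u : ReducedEnvelopingAlgebra p pm χ, u • v = q)
    (hC : ∀ x t, (x, t) ∈ C → toReduced p pm χ x • v = t • v) :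
    HasCyclicDatum p pm C (finrank K Q) b χ := by
  let f : ReducedEnvelopingAlgebra p pm χ →ₐ[K] Module.End K Q := Algebra.lsmul K K Q
  refine exists_isCyclicDatum_of_basis (finBasis K Q) (isReducedRep_toReduced.map_algHom f) (v := v)
    hC ?_
  let ev : ReducedEnvelopingAlgebra p pm χ →ₗ[K] Q :=
    (LinearMap.toSpanSingleton (ReducedEnvelopingAlgebra p pm χ) Q v).restrictScalars K
  have hev : Function.Surjective ev := hv
  have h := congrArg (Submodule.map ev)
    (letterSpan_toReduced_pow_eq_top (pm := pm) (χ := χ) hp b)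
  rw [letterSpan_pow_eq_span_word, Submodule.map_span, Submodule.map_top,
    LinearMap.range_eq_top.mpr hev, ← Set.range_comp] at h
  rw [← h]
  refine congrArg (fun g => Submodule.span K (Set.range g)) (funext fun w => ?_)
  exact (congrArg (fun g : Module.End K Q => g v) (map_word f.toRingHom _ w)).symm

/-- Matrix data with `p`-character `χ` define a quotient of the reduced enveloping algebra by a left
ideal, namely the annihilator of the cyclic vector. -/
theorem HasCyclicDatum.exists_quotient {e : ℕ} {b : Basis ι K L}
    (h : HasCyclicDatum p pm C e b χ) :
    ∃ J : Submodule (ReducedEnvelopingAlgebra p pm χ) (ReducedEnvelopingAlgebra p pm χ),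
      (∀ x t, (x, t) ∈ C → toReduced p pm χ x - algebraMap K _ t ∈ J) ∧
        finrank K (ReducedEnvelopingAlgebra p pm χ ⧸ J) = e := by
  obtain ⟨ρ, v, a, hd⟩ := h
  let ρL : L →ₗ⁅K⁆ Matrix (Fin e) (Fin e) K :=
    { toFun := ρ
      map_add' := hd.rep.map_add
      map_smul' := hd.rep.map_smul
      map_lie' := fun {x y} => hd.rep.map_lie x y }
  let F : ReducedEnvelopingAlgebra p pm χ →ₐ[K] Matrix (Fin e) (Fin e) K :=
    RingQuot.liftAlgHom K ⟨UniversalEnvelopingAlgebra.lift K ρL, fun u u' hu => by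
      cases hu with
      | rel x =>
        rw [map_sub, map_pow, UniversalEnvelopingAlgebra.lift_ι_apply,
          UniversalEnvelopingAlgebra.lift_ι_apply, AlgHom.commutes, sub_eq_iff_eq_add']
        exact hd.rep.map_pow x⟩
  have hF (x : L) : F (toReduced p pm χ x) = ρ x := by
    simp only [F, toReduced]
    rw [RingQuot.liftAlgHom_mkAlgHom_apply, UniversalEnvelopingAlgebra.lift_ι_apply]
    rfl
  let J : Submodule (ReducedEnvelopingAlgebra p pm χ) (ReducedEnvelopingAlgebra p pm χ) :=
    { carrier := {u | (F u).mulVec v = 0}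
      add_mem' := fun {u u'} hu hu' => by
        change (F (u + u')).mulVec v = 0
        rw [map_add, Matrix.add_mulVec, hu, hu', add_zero]
      zero_mem' := by
        change (F 0).mulVec v = 0
        rw [map_zero, Matrix.zero_mulVec]
      smul_mem' := fun r u hu => by
        change (F (r * u)).mulVec v = 0
        rw [map_mul, ← Matrix.mulVec_mulVec, hu, Matrix.mulVec_zero] }
  refine ⟨J, fun x t hx => ?_, ?_⟩
  · change (F (toReduced p pm χ x - algebraMap K _ t)).mulVec v = 0
    rw [map_sub, hF, AlgHom.commutes, Matrix.sub_mulVec, hd.eigen x t hx,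
      Algebra.algebraMap_eq_smul_one (A := Matrix (Fin e) (Fin e) K), Matrix.smul_mulVec,
      Matrix.one_mulVec]
    exact sub_self _
  · let g : ReducedEnvelopingAlgebra p pm χ →ₗ[K] (Fin e → K) :=
      { toFun := fun u => (F u).mulVec v
        map_add' := fun u u' => by rw [map_add, Matrix.add_mulVec]
        map_smul' := fun r u => by rw [map_smul, Matrix.smul_mulVec]; rfl }
    have hg : Function.Surjective g := by
      rw [← LinearMap.range_eq_top, eq_top_iff, ← hd.span_eq_top, Submodule.span_le]
      rintro _ ⟨w, rfl⟩
      refine ⟨word (fun i => toReduced p pm χ (b i)) w, ?_⟩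
      have h1 := map_word F.toRingHom (fun i => toReduced p pm χ (b i)) w
      refine (congrArg (fun A : Matrix (Fin e) (Fin e) K => A.mulVec v) h1).trans ?_
      exact congrArg (fun X : ι → Matrix (Fin e) (Fin e) K => (word X w).mulVec v)
        (funext fun i => hF (b i))
    have hJ : LinearMap.ker g = J.restrictScalars K := rfl
    rw [← (Submodule.Quotient.restrictScalarsEquiv K J).finrank_eq, ← hJ,
      (g.quotKerEquivOfSurjective hg).finrank_eq, finrank_fin_fun]

theorem HasCyclicDatum.le_card {e : ℕ} {b : Basis ι K L} {χ : L → K}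
    (h : HasCyclicDatum p pm C e b χ) :
    e ≤ Fintype.card (Fin (Fintype.card ι * (p - 1)) → Option ι) := by
  obtain ⟨ρ, v, a, hd⟩ := h
  have h1 := finrank_range_le_card (R := K)
    fun w : Fin (Fintype.card ι * (p - 1)) → Option ι =>
      (word (fun i => ρ (b i)) w).mulVec v
  rwa [Set.finrank, hd.span_eq_top, finrank_top, finrank_fin_fun] at h1

/-- All submodules of `U ⧸ I` have dimension divisible by `d` if and only if all its quotients do,
that is, all finite-dimensional cyclic representations satisfying the relations that define `I`. -/
theorem forall_dvd_finrank_iff (hp : 2 ≤ p) (b : Basis ι K L) (d : ℕ)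
    (I : Submodule (ReducedEnvelopingAlgebra p pm χ) (ReducedEnvelopingAlgebra p pm χ))
    (hI : I = Submodule.span _
      {u | ∃ x t, (x, t) ∈ C ∧ u = toReduced p pm χ x - algebraMap K _ t}) :
    (∀ M : Submodule (ReducedEnvelopingAlgebra p pm χ) (ReducedEnvelopingAlgebra p pm χ ⧸ I),
      d ∣ finrank K M) ↔ ∀ e, HasCyclicDatum p pm C e b χ → d ∣ e := by
  have := finite_reducedEnvelopingAlgebra (pm := pm) (χ := χ) hp b
  have hZ : Module.Finite K (ReducedEnvelopingAlgebra p pm χ ⧸ I) :=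
    Module.Finite.of_surjective (I.mkQ.restrictScalars K) I.mkQ_surjective
  have hadd (M : Submodule (ReducedEnvelopingAlgebra p pm χ)
      (ReducedEnvelopingAlgebra p pm χ ⧸ I)) :
      finrank K ((ReducedEnvelopingAlgebra p pm χ ⧸ I) ⧸ M) + finrank K M =
        finrank K (ReducedEnvelopingAlgebra p pm χ ⧸ I) := by
    rw [← (Submodule.Quotient.restrictScalarsEquiv K M).finrank_eq]
    exact (M.restrictScalars K).finrank_quotient_add_finrank
  constructor
  · intro h e he
    obtain ⟨J, hJ, rfl⟩ := he.exists_quotient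
    have hIJ : I ≤ J := by
      rw [hI, Submodule.span_le]
      rintro _ ⟨x, t, hx, rfl⟩
      exact hJ x t hx
    rw [← ((Submodule.quotientQuotientEquivQuotient I J hIJ).restrictScalars K).finrank_eq]
    rw [Nat.dvd_add_iff_left (h (J.map I.mkQ)), hadd]
    have := h ⊤
    rwa [((Submodule.topEquiv (R := ReducedEnvelopingAlgebra p pm χ)
      (M := ReducedEnvelopingAlgebra p pm χ ⧸ I)).restrictScalars K).finrank_eq] at this
  · intro h
    have hq (M : Submodule (ReducedEnvelopingAlgebra p pm χ)
        (ReducedEnvelopingAlgebra p pm χ ⧸ I)) :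
        d ∣ finrank K ((ReducedEnvelopingAlgebra p pm χ ⧸ I) ⧸ M) := by
      have : Module.Finite K ((ReducedEnvelopingAlgebra p pm χ ⧸ I) ⧸ M) :=
        Module.Finite.of_surjective (M.mkQ.restrictScalars K) M.mkQ_surjective
      refine h _ (hasCyclicDatum_of_cyclic hp b (v := M.mkQ (I.mkQ 1)) (fun q => ?_)
        fun x t hx => ?_)
      · obtain ⟨z, rfl⟩ := M.mkQ_surjective q
        obtain ⟨u, rfl⟩ := I.mkQ_surjective z
        exact ⟨u, by rw [← map_smul, ← map_smul, smul_eq_mul, mul_one]⟩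
      · rw [← sub_eq_zero, ← algebraMap_smul (ReducedEnvelopingAlgebra p pm χ) t, ← sub_smul,
          ← map_smul, ← map_smul, smul_eq_mul, mul_one]
        have h0 : I.mkQ (toReduced p pm χ x - algebraMap K _ t) = 0 := by
          rw [Submodule.mkQ_apply, Submodule.Quotient.mk_eq_zero, hI]
          exact Submodule.subset_span ⟨x, t, hx, rfl⟩
        rw [h0, map_zero]
    intro M
    rw [Nat.dvd_add_iff_right (hq M), hadd]
    have h0 := hadd ⊥
    have hbot : finrank K (⊥ : Submodule (ReducedEnvelopingAlgebra p pm χ)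
      (ReducedEnvelopingAlgebra p pm χ ⧸ I)) = 0 := finrank_zero_of_subsingleton
    rw [hbot, add_zero] at h0
    exact h0 ▸ hq ⊥

end ReducedEnveloping

/-! ### Zariski topology on a vector space -/

section Zariski

variable {K V : Type*} [Field K] [AddCommGroup V] [Module K V]

theorem isOpen_zariskiVec_basic (f : MvPolynomial (Dual K V) K) :
    IsOpen[zariskiVec K V] {v | MvPolynomial.eval (fun l : Dual K V => l v) f ≠ 0} :=
  TopologicalSpace.isOpen_generateFrom_of_mem ⟨f, rfl⟩

theorem exists_basic_subset_of_isOpen {U : Set V} (hU : IsOpen[zariskiVec K V] U) {x : V}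
    (hx : x ∈ U) : ∃ f : MvPolynomial (Dual K V) K,
      MvPolynomial.eval (fun l : Dual K V => l x) f ≠ 0 ∧
        {v | MvPolynomial.eval (fun l : Dual K V => l v) f ≠ 0} ⊆ U := by
  have hU' : TopologicalSpace.GenerateOpen {U : Set V | ∃ f : MvPolynomial (Dual K V) K,
    U = {v | MvPolynomial.eval (fun l : Dual K V => l v) f ≠ 0}} U := hU
  induction hU' with
  | basic s hs =>
    obtain ⟨f, rfl⟩ := hs
    exact ⟨f, hx, subset_rfl⟩
  | univ => exact ⟨1, by simp, Set.subset_univ _⟩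
  | inter s t hs ht ihs iht =>
    obtain ⟨f, hf, hfs⟩ := ihs hs hx.1
    obtain ⟨g, hg, hgt⟩ := iht ht hx.2
    refine ⟨f * g, by rw [map_mul]; exact mul_ne_zero hf hg, fun v hv => ?_⟩
    rw [Set.mem_ofPred_eq, map_mul] at hv
    exact ⟨hfs (left_ne_zero_of_mul hv), hgt (right_ne_zero_of_mul hv)⟩
  | sUnion S hS ih =>
    obtain ⟨s, hs, hxs⟩ := hx
    obtain ⟨f, hf, hfs⟩ := ih s hs (hS s hs) hxs
    exact ⟨f, hf, hfs.trans (Set.subset_sUnion_of_mem hs)⟩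

/-- Vector spaces over infinite fields are irreducible: restrict two polynomials to the line through
points where they do not vanish. -/
theorem dense_of_isOpen_zariskiVec [Infinite K] {U : Set V} (hU : IsOpen[zariskiVec K V] U)
    (hne : U.Nonempty) : @Dense V (zariskiVec K V) U := by
  let _ : TopologicalSpace V := zariskiVec K V
  rw [dense_iff_inter_open]
  rintro W hW ⟨y, hy⟩
  obtain ⟨x, hx⟩ := hne
  obtain ⟨f, hf, hfU⟩ := exists_basic_subset_of_isOpen hU hx
  obtain ⟨g, hg, hgW⟩ := exists_basic_subset_of_isOpen hW hy
  let r : MvPolynomial (Dual K V) K →ₐ[K] Polynomial K := MvPolynomial.aeval fun l =>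
    Polynomial.C (l x) + Polynomial.X * Polynomial.C (l (y - x))
  have hr (q : MvPolynomial (Dual K V) K) (t : K) :
      (r q).eval t = MvPolynomial.eval (fun l : Dual K V => l (x + t • (y - x))) q := by
    have h : (Polynomial.aeval t).comp r =
        MvPolynomial.aeval fun l : Dual K V => l (x + t • (y - x)) := by
      ext l
      simp only [r, AlgHom.comp_apply, MvPolynomial.aeval_X, map_add, map_mul, map_sub, map_smul,
        Polynomial.aeval_C, Polynomial.aeval_X, Algebra.algebraMap_self, RingHom.id_apply,
        smul_eq_mul]
    have h1 := DFunLike.congr_fun h q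
    rw [MvPolynomial.aeval_eq_eval] at h1
    rw [← Polynomial.coe_aeval_eq_eval]
    exact h1
  have h0 : r f * r g ≠ 0 := by
    refine mul_ne_zero (fun h => hf ?_) (fun h => hg ?_)
    · have := hr f 0
      rw [h] at this
      simpa using this.symm
    · have := hr g 1
      rw [h] at this
      simpa using this.symm
  obtain ⟨t, ht⟩ : ∃ t, (r f * r g).eval t ≠ 0 := by
    by_contra! hc
    exact h0 (Polynomial.funext fun t => by rw [hc t, Polynomial.eval_zero])
  rw [Polynomial.eval_mul, hr, hr] at ht
  exact ⟨x + t • (y - x), hgW (right_ne_zero_of_mul ht), hfU (left_ne_zero_of_mul ht)⟩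

end Zariski

/-! ### The divisible locus -/

section DivisibleLocus

variable {K L ι V : Type*} [Field K] [IsAlgClosed K] [LieRing L] [LieAlgebra K L] [Fintype ι]
  {p : ℕ} {pm : L → L} {C : Set (L × K)} [AddCommGroup V] [Module K V]

/-- The locus where all cyclic representations have dimension divisible by `d` is the complement of
finitely many closed sets, as their dimension is bounded by the number of words. -/
theorem isOpen_setOf_forall_dvd (hp : 2 ≤ p) (b : Basis ι K L) (m : V →ₗ[K] Dual K L) (d : ℕ) :
    IsOpen[zariskiVec K V] {μ | ∀ e, HasCyclicDatum p pm C e b (m μ) → d ∣ e} := by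
  let _ : TopologicalSpace V := zariskiVec K V
  have hclosed (e : ℕ) : IsOpen {μ | ¬ HasCyclicDatum p pm C e b (m μ)} := by
    rw [isOpen_iff_forall_mem_open]
    intro μ₀ hμ₀
    by_contra! hc
    refine hμ₀ (hasCyclicDatum_of_forall_eval_ne_zero hp b m μ₀ fun f hf => ?_)
    by_contra! hE
    exact hc {μ | MvPolynomial.eval (fun l : Dual K V => l μ) f ≠ 0} (fun μ hμ h => hμ (hE μ h))
      (isOpen_zariskiVec_basic f) hf
  have h : {μ | ∀ e, HasCyclicDatum p pm C e b (m μ) → d ∣ e} =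
      ⋂ e ∈ (Finset.range (Fintype.card (Fin (Fintype.card ι * (p - 1)) → Option ι) + 1)).filter
        fun e => ¬ d ∣ e, {μ | ¬ HasCyclicDatum p pm C e b (m μ)} := by
    ext μ
    simp only [Set.mem_ofPred_eq, Set.mem_iInter, Finset.mem_filter, Finset.mem_range]
    exact ⟨fun h e he hd => he.2 (h e hd), fun h e hd => not_not.mp fun hn =>
      h e ⟨Nat.lt_succ_of_le hd.le_card, hn⟩ hd⟩
  rw [h]
  exact isOpen_biInter_finset fun e _ => hclosed e

end DivisibleLocus

/-! ### Baby Verma modules -/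

theorem babyVermaIdeal_eq_span {K : Type*} [Field K] {n : ℕ} (p : ℕ) [Fact p.Prime] [CharP K p]
    (G B T : Subgroup (GL (Fin n) K)) (χ : Dual K (lieAlg G)) (lam : Dual K (lieAlg T)) :
    babyVermaIdeal p G B T χ lam = Submodule.span (UChi p G χ)
      {u | ∃ (x : lieAlg G) (t : K),
        (x, t) ∈ {q : lieAlg G × K | ((q.1 : Matrix (Fin n) (Fin n) K) ∈ nPlus G B T ∧ q.2 = 0) ∨
          ∃ hx : (q.1 : Matrix (Fin n) (Fin n) K) ∈ lieAlg T, q.2 = lam ⟨q.1, hx⟩} ∧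
        u = toReduced p (pMap p G) χ x - algebraMap K _ t} := by
  rw [babyVermaIdeal]
  congr 1
  ext u
  constructor
  · rintro (⟨x, hx, rfl⟩ | ⟨x, hx, rfl⟩)
    · exact ⟨x, 0, Or.inl ⟨hx, rfl⟩, by rw [map_zero, sub_zero]; rfl⟩
    · exact ⟨x, _, Or.inr ⟨hx, rfl⟩, rfl⟩
  · rintro ⟨x, t, ⟨hx, ht⟩ | ⟨hx, ht⟩, rfl⟩
    · obtain rfl : t = 0 := ht
      exact Or.inl ⟨x, hx, by rw [map_zero, sub_zero]; rfl⟩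
    · exact Or.inr ⟨x, hx, by rw [show t = lam ⟨x, hx⟩ from ht]; rfl⟩

theorem mainTheorem7 {K : Type*} [Field K] [IsAlgClosed K] (p : ℕ) [Fact p.Prime] [CharP K p]
    {n : ℕ} (G B T : Subgroup (GL (Fin n) K))
    (hG : IsConnectedReductive G) (hT : IsMaximalTorus G T) (hB : IsBorelSubgroup G B)
    (hTB : T ≤ B)
    (lam : Module.Dual K (lieAlg T)) (hlam : lam ∈ Lambda0 p T)
    (k : ℕ) (hk : k ≤ (posRoots G B T).ncard)
    (hχ : ∃ χ ∈ bPerp G B, AllSubmodulesDivisible p G B T χ lam k) :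
    IsOpen[zariskiVec K (bPerp G B)] (divisibleLocus p G B T lam k) ∧
      @Dense (bPerp G B) (zariskiVec K (bPerp G B)) (divisibleLocus p G B T lam k) := by
  have hp : 2 ≤ p := (Fact.out : p.Prime).two_le
  have hopen : IsOpen[zariskiVec K (bPerp G B)] (divisibleLocus p G B T lam k) := by
    have h := isOpen_setOf_forall_dvd (V := bPerp G B) (pm := pMap p G)
      (C := {q : lieAlg G × K | ((q.1 : Matrix (Fin n) (Fin n) K) ∈ nPlus G B T ∧ q.2 = 0) ∨
          ∃ hx : (q.1 : Matrix (Fin n) (Fin n) K) ∈ lieAlg T, q.2 = lam ⟨q.1, hx⟩})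
      hp (finBasis K (lieAlg G)) (bPerp G B).subtype (p ^ k)
    refine (congrArg (fun U => IsOpen[zariskiVec K (bPerp G B)] U) (Set.ext fun μ => ?_)).mp h
    exact (forall_dvd_finrank_iff hp (finBasis K (lieAlg G)) (p ^ k) _
      (babyVermaIdeal_eq_span p G B T (μ : Dual K (lieAlg G)) lam)).symm
  have : Infinite K := IsAlgClosed.instInfinite
  obtain ⟨χ, hχB, hχ⟩ := hχ
  exact ⟨hopen, dense_of_isOpen_zariskiVec hopen ⟨⟨χ, hχB⟩, hχ⟩⟩
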